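/- **Conventions.** A monoid is a commutative cancellative semigroup with unit. For a monoid $H$ let $H_{\mathrm{red}}=\{aH^\times\mid a\in H\}$, let $\mathcal F(P)$ be the free abelian monoid with basis $P$, let $\mathsf Z(H)=\mathcal F(\mathcal A(H_{\mathrm{red}}))$ be the free monoid on the atoms of $H_{\mathrm{red}}$, and for $a\in H$ let $\mathsf Z(a)\subset\mathsf Z(H)$ be the set of factorizations of $a$ (the elements of $\mathsf Z(H)$ whose product in $H_{\mathrm{red}}$ is $aH^\times$) and $\mathsf L(a)=\{|z| \mid z\in\mathsf Z(a)\}$ its set of lengths. For $z,z'\in\mathsf Z(H)$ put $\mathsf d(z,z')=\max\{|z\gcd(z,z')^{-1}|,|z'\gcd(z,z')^{-1}|\}$. For $a\in H$ and $x\in\mathsf Z(H)$ let $\mathsf t(a,x)\in\mathbb N_0\cup\{\infty\}$ be the smallest $N$ such that, if $\mathsf Z(a)\cap x\mathsf Z(H)\neq\emptyset$ and $z\in\mathsf Z(a)$, then $\mathsf d(z,z')\le N$ for some $z'\in\mathsf Z(a)\cap x\mathsf Z(H)$; for $X\subset\mathsf Z(H)$ let $\mathsf t(a,X)=\sup_{x\in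 X}\mathsf t(a,x)$. A subset $\mathfrak a\subset H$ is a *pattern ideal* if there is a finite nonempty $A\subset\mathbb Z$ such that $\mathfrak a=\{a\in H\mid y+A\subset\mathsf L(a)\text{ for some }y\in\mathbb Z\}$. It is *tamely generated* if there are a subset $E\subset\mathfrak a$ and $N\in\mathbb N$ such that for every $a\in\mathfrak a$ there is $e\in E$ with $e\mid a$, $\sup\mathsf L(e)\le N$ and $\mathsf t(a,\mathsf Z(e))\le N$. A monoid homomorphism $\varphi\colon H\to D$ is a *divisor homomorphism* if $\varphi(a)\mid\varphi(b)$ implies $a\mid b$, and *cofinal* if every element of $D$ divides some $\varphi(u)$, $u\in H$. Its class group is $\mathcal C(\varphi)=\mathsf q(D)/\mathsf q(\varphi(H))$, written additively, where $\mathsf q$ denotes the quotient group. $H$ is a *Krull monoid* if $H_{\mathrm{red}}$ is isomorphic to a submonoid of a free monoid whose inclusion is a divisor homomorphism. For $G_0\subset\mathbb Z$, $\mathcal B(G_0)\subset\mathcal F(G_0)$ is the monoid of zero-sum sequences over $G_0$, i.e. of those $g_1\cdots g_l\in\mathcal F(G_0)$ with $g_1+\dots+g_l=0$ in $\mathbb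 Z$. **Proposition.** Let $H$ be a Krull monoid and $\varphi\colon H\to\mathcal F(P)$ a cofinal divisor homomorphism whose class group $G=\mathcal C(\varphi)$ is infinite cyclic; identify $G$ with $\mathbb Z$ by a group isomorphism. Let $G_P=\{[p]\mid p\in P\}\subset\mathbb Z$ be the set of classes containing prime divisors, $G_P^+=\{g\in G_P\mid g>0\}$ and $G_P^-=\{g\in G_P\mid g<0\}$. Suppose that $G_P^+$ is infinite and that there are $a_1,a_2\in G_P^-$ and $b\in G_P^+$ such that $$a_1\frac{\gcd(a_2,b)}{\gcd(a_1,a_2,b)}\equiv a_2\frac{\gcd(a_1,b)}{\gcd(a_1,a_2,b)}\pmod b\quad\text{but}\quad a_1\frac{\gcd(a_2,b)}{\gcd(a_1,a_2,b)}\neq a_2\frac{\gcd(a_1,b)}{\gcd(a_1,a_2,b)},$$ where greatest common divisors are taken nonnegative. Then $H$ has a pattern ideal which is not tamely generated, and $\mathcal B(G_P)$ has a pattern ideal which is not tamely generated. -/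

import Mathlib

/-! ### Factorizations in commutative monoids -/

namespace KrullFactorization

/-- The free (abelian) monoid with basis `P`, written multiplicatively: finite multisets over `P`
with addition of multiplicities as the operation. -/
abbrev FreeMon (P : Type*) : Type _ := Multiplicative (Multiset P)

/-- The basis element of the free monoid given by `p`. -/
def FreeMon.of {P : Type*} (p : P) : FreeMon P := Multiplicative.ofAdd ({p} : Multiset P)

section Factorizations

variable (H : Type*) [CommMonoid H]

/-- The atoms of the associated reduced monoid `H_red = Associates H`. -/
abbrev Atom : Type _ := {u : Associates H // Irreducible u}

/-- The factorization monoid of `H`, i.e. the free monoid whose basis is the set of atoms of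
`H_red`. It is written additively here, so that `Multiset.card` is the length, and the relation
`x ≤ z` says exactly that `z` is of the form `x + y`. -/
abbrev Factorization : Type _ := Multiset (Atom H)

variable {H}

/-- The factorization homomorphism `Z(H) → H_red`. -/
def Factorization.eval (z : Factorization H) : Associates H :=
  (z.map (fun u : Atom H => (u : Associates H))).prod

/-- The set `Z(a)` of factorizations of `a`. -/
def factorizations (a : H) : Set (Factorization H) :=
  {z | z.eval = Associates.mk a}

/-- The set `L(a)` of lengths of `a`. -/
def lengths (a : H) : Set ℕ :=
  {n | ∃ z ∈ factorizations a, Multiset.card z = n}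

open Classical in
/-- The distance of two factorizations: remove the greatest common divisor (the multiset
intersection) from both and take the larger of the two remaining lengths. -/
noncomputable def dist (z z' : Factorization H) : ℕ :=
  max (Multiset.card (z - z ∩ z')) (Multiset.card (z' - z ∩ z'))

/-- The tame degree `t(a, x) ∈ ℕ₀ ∪ {∞}`: the smallest `N` such that, if some factorization of `a`
is divisible by `x`, then every factorization `z` of `a` has distance at most `N` from some
factorization of `a` that is divisible by `x`. -/
noncomputable def tameDegree (a : H) (x : Factorization H) : ℕ∞ :=
  sInf {N : ℕ∞ | (∃ y ∈ factorizations a, x ≤ y) →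
    ∀ z ∈ factorizations a, ∃ z' ∈ factorizations a, x ≤ z' ∧ (dist z z' : ℕ∞) ≤ N}

/-- `t(a, X) = sup {t(a, x) | x ∈ X}` for a set `X` of factorizations. -/
noncomputable def tameDegreeSet (a : H) (X : Set (Factorization H)) : ℕ∞ :=
  ⨆ x ∈ X, tameDegree a x

/-- The set `L` of integers contains the pattern `A`. -/
def ContainsPattern (L : Set ℤ) (A : Finset ℤ) : Prop :=
  ∃ y : ℤ, ∀ x ∈ A, y + x ∈ L

variable (H) in
/-- `Φ_H(A)`: the set of all elements of `H` whose set of lengths contains the pattern `A`. -/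
def patternSet (A : Finset ℤ) : Set H :=
  {a | ContainsPattern ((fun n : ℕ => (n : ℤ)) '' lengths a) A}

/-- A pattern ideal is a set of the form `Φ_H(A)` with `A` a finite nonempty set of integers. -/
def IsPatternIdeal (I : Set H) : Prop :=
  ∃ A : Finset ℤ, A.Nonempty ∧ I = patternSet H A

/-- `E` is a tame generating set of `I` with bound `N`. -/
def IsTameGeneratingSet (E I : Set H) (N : ℕ) : Prop :=
  E ⊆ I ∧ ∀ a ∈ I, ∃ e ∈ E, e ∣ a ∧ (⨆ l ∈ lengths e, (l : ℕ∞)) ≤ (N : ℕ∞) ∧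
    tameDegreeSet a (factorizations e) ≤ (N : ℕ∞)

/-- `I` has a tame generating set, with some positive bound. -/
def IsTamelyGenerated (I : Set H) : Prop :=
  ∃ (E : Set H) (N : ℕ), 0 < N ∧ IsTameGeneratingSet E I N

end Factorizations

/-! ### Divisor homomorphisms, Krull monoids and class groups -/

section Krull

universe u

/-- A divisor homomorphism reflects divisibility. -/
def IsDivisorHom {H D : Type*} [CommMonoid H] [CommMonoid D] (φ : H →* D) : Prop :=
  ∀ a b : H, φ a ∣ φ b → a ∣ b

/-- A homomorphism is cofinal if every element of the target divides an element of the image. -/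
def IsCofinalHom {H D : Type*} [CommMonoid H] [CommMonoid D] (φ : H →* D) : Prop :=
  ∀ a : D, ∃ u : H, a ∣ φ u

/-- A (commutative, cancellative) monoid is a Krull monoid if its associated reduced monoid is
(isomorphic to) a saturated submonoid of a free monoid. -/
def IsKrullMonoid (H : Type u) [CancelCommMonoid H] : Prop :=
  ∃ (P : Type u) (j : Associates H →* FreeMon P), Function.Injective j ∧ IsDivisorHom j

variable {H D : Type*} [CommMonoid H] [CommMonoid D]

/-- The subgroup `q(φ(H))` of the quotient group `q(D)`, generated by the image of `H`. -/
def imageQuotientGroup (φ : H →* D) : Subgroup (Algebra.GrothendieckGroup D) :=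
  Subgroup.closure (Set.range fun a : H => Algebra.GrothendieckGroup.of (φ a))

/-- The class group `q(D) / q(φ(H))` of `φ`, written additively. -/
abbrev ClassGroup (φ : H →* D) : Type _ :=
  Additive (Algebra.GrothendieckGroup D ⧸ imageQuotientGroup φ)

/-- The class `[a]` of an element `a` of `D`. -/
def classOf (φ : H →* D) (a : D) : ClassGroup φ :=
  Additive.ofMul (QuotientGroup.mk (Algebra.GrothendieckGroup.of a))

/-- The set of classes containing prime divisors. -/
def primeClasses {P : Type*} (φ : H →* FreeMon P) : Set (ClassGroup φ) :=
  Set.range fun p : P => classOf φ (FreeMon.of p)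

end Krull

/-! ### Zero-sum sequences -/

/-- The monoid `B(G₀)` of zero-sum sequences over a subset `G₀` of an abelian group, as a submonoid
of the free monoid with basis `G₀`. -/
def zeroSumMonoid {G : Type*} [AddCommGroup G] (G₀ : Set G) : Submonoid (FreeMon G₀) where
  carrier := {S | ((Multiplicative.toAdd S).map (fun g : G₀ => (g : G))).sum = 0}
  one_mem' := by simp
  mul_mem' := by
    intro S T hS hT
    simp only [Set.mem_ofPred_eq] at hS hT ⊢
    rw [toAdd_mul, Multiset.map_add, Multiset.sum_add, hS, hT, add_zero]

end KrullFactorization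

/-! Both monoids are handled at once. In each case the reduced monoid is the monoid of all sequences
of weight zero over letters with integer weights, the weight of a prime being its class. Take
letters `p₁`, `p₂`, `q` of weights `-α₁ = a₁`, `-α₂ = a₂`, `b`, put `dᵢ = gcd(αᵢ, b)`, and let `r`
be a letter of very large weight `c`.

The congruence makes sequences over `p₁, p₂, q` half-factorial: every atom `p₁^s p₂^t q^v` satisfies
`d₁ s + d₂ t = b` (`atom_norm`). Hence an element over the four letters with two different lengths
must contain `r` (`mem_of_card_ne`).

The inequality `α₁ d₂ ≠ α₂ d₁` yields an element `a` with two lengths at a distance `D > 0` bounded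
independently of `c` (`exists_element`). It has one factorization in which no atom contains both `r`
and `p₂`, and one in which no atom contains both `r` and `p₁`.

If `e` divides `a` and has two lengths, some atom `X` in a factorization of `e` contains `r`, so by
weight it contains `p₁` or `p₂` about `c` times up to a constant factor. Forcing `X` into the
corresponding separated factorization must pull that many letters out of `r`-free atoms, each
holding at most `b` of them, so the tame degree grows with `c` (`le_of_tameDegreeSet_le`). Only
finitely many `D` occur, so the pattern ideals of all `{0, D}` cannot be tamely generated together.
-/

namespace KrullFactorization

/-! ### Arithmetic of the congruence condition. -/

section Arithmetic

/-- Write `d₁ = u₂ g`, `d₂ = u₁ g` with `u₁, u₂` coprime. Divisibility by `d₁` and `d₂` forces `s =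
u₁ i` and `t = u₂ j`. By the congruence, `α₁ u₁` and `α₂ u₂` are the same residue modulo `b`, of
order `k = b / (d₂ u₂)`, so `k ∣ i + j`. Any `i' ≤ i`, `j' ≤ j` with `i' + j' = k` then gives a
zero-sum part, and its norm is `g u₁ u₂ k = b`. -/
theorem exists_zeroSum_le_of_modEq {α₁ α₂ b : ℕ} (hb : 0 < b)
    (hcong : α₁ * (α₂.gcd b / (α₁.gcd b).gcd (α₂.gcd b)) ≡
      α₂ * (α₁.gcd b / (α₁.gcd b).gcd (α₂.gcd b)) [MOD b])
    {s t v : ℕ} (h : s * α₁ + t * α₂ = v * b) (hpos : 0 < s + t) :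
    ∃ s' t' v', s' ≤ s ∧ t' ≤ t ∧ v' ≤ v ∧ s' * α₁ + t' * α₂ = v' * b ∧
      α₁.gcd b * s' + α₂.gcd b * t' = b := by
  obtain ⟨d₁, hd₁⟩ : ∃ d, d = α₁.gcd b := ⟨_, rfl⟩
  obtain ⟨d₂, hd₂⟩ : ∃ d, d = α₂.gcd b := ⟨_, rfl⟩
  rw [← hd₁, ← hd₂] at hcong ⊢
  have hd₁pos : 0 < d₁ := hd₁ ▸ Nat.gcd_pos_of_pos_right _ hb
  have hd₂pos : 0 < d₂ := hd₂ ▸ Nat.gcd_pos_of_pos_right _ hb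
  have hd₁b : d₁ ∣ b := hd₁ ▸ Nat.gcd_dvd_right _ _
  have hd₂b : d₂ ∣ b := hd₂ ▸ Nat.gcd_dvd_right _ _
  have hd₁α : d₁ ∣ α₁ := hd₁ ▸ Nat.gcd_dvd_left _ _
  have hd₂α : d₂ ∣ α₂ := hd₂ ▸ Nat.gcd_dvd_left _ _
  obtain ⟨g, u₂, u₁, hg, hcop, hu₂, hu₁⟩ := Nat.exists_coprime' (m := d₁) (n := d₂)
    (Nat.gcd_pos_of_pos_left _ hd₁pos)
  have hgcd : d₁.gcd d₂ = g := by
    rw [hu₂, hu₁, Nat.gcd_mul_right, hcop.gcd_eq_one, one_mul]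
  have e₁ : d₁ / g = u₂ := by rw [hu₂, Nat.mul_div_cancel _ hg]
  have e₂ : d₂ / g = u₁ := by rw [hu₁, Nat.mul_div_cancel _ hg]
  rw [hgcd, e₁, e₂] at hcong
  have hs : u₁ ∣ s := by
    have : d₂ ∣ s * d₁ := by
      rw [hd₁, ← Nat.gcd_mul_left]
      refine Nat.dvd_gcd ?_ (hd₂b.mul_left _)
      exact (Nat.dvd_add_left (hd₂α.mul_left t)).1 (h ▸ hd₂b.mul_left v)
    rw [hu₁, hu₂, ← mul_assoc] at this
    exact hcop.symm.dvd_of_dvd_mul_right (Nat.dvd_of_mul_dvd_mul_right hg this)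
  have ht : u₂ ∣ t := by
    have : d₁ ∣ t * d₂ := by
      rw [hd₂, ← Nat.gcd_mul_left]
      refine Nat.dvd_gcd ?_ (hd₁b.mul_left _)
      exact (Nat.dvd_add_right (hd₁α.mul_left s)).1 (h ▸ hd₁b.mul_left v)
    rw [hu₁, hu₂, ← mul_assoc] at this
    exact hcop.dvd_of_dvd_mul_right (Nat.dvd_of_mul_dvd_mul_right hg this)
  obtain ⟨i, rfl⟩ := hs
  obtain ⟨j, rfl⟩ := ht
  obtain ⟨c, hc⟩ := hd₂b
  obtain ⟨y, hy⟩ := hd₂α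
  -- `y` and `c` are the cofactors of `d₂ = gcd(α₂, b)` in `α₂` and `b`; since `k ∣ c`, `y` can
  -- later be cancelled modulo `k`.
  have hcy : Nat.Coprime y c := by
    have : d₂ * Nat.gcd y c = d₂ * 1 := by
      rw [← Nat.gcd_mul_left, ← hy, ← hc, ← hd₂, mul_one]
    exact Nat.eq_of_mul_eq_mul_left hd₂pos this
  have hu₂c : u₂ ∣ c := by
    have : u₂ * g ∣ u₁ * c * g := by
      rw [← hu₂]
      convert hd₁b using 1
      rw [hc, hu₁]; ring
    exact hcop.dvd_of_dvd_mul_left (Nat.dvd_of_mul_dvd_mul_right hg this)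
  obtain ⟨k, hk⟩ := hu₂c
  have hbk : b = (d₂ * u₂) * k := by rw [hc, hk]; ring
  have hmod : b ∣ (i + j) * (α₂ * u₂) := by
    rw [← Nat.modEq_zero_iff_dvd]
    calc (i + j) * (α₂ * u₂) = i * (α₂ * u₂) + j * (α₂ * u₂) := by ring
      _ ≡ i * (α₁ * u₁) + j * (α₂ * u₂) [MOD b] :=
        (Nat.ModEq.mul_left i hcong.symm).add_right _
      _ = v * b := by rw [← h]; ring
      _ ≡ 0 [MOD b] := (Nat.modEq_zero_iff_dvd).2 (dvd_mul_left _ _)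
  have hu₂pos : 0 < u₂ := Nat.pos_of_ne_zero fun h0 => by simp [h0] at hu₂; omega
  have hkij : k ∣ i + j := by
    have h3 : (d₂ * u₂) * k ∣ (d₂ * u₂) * ((i + j) * y) := by
      rw [← hbk]
      convert hmod using 1
      rw [hy]; ring
    have h4 := Nat.dvd_of_mul_dvd_mul_left (Nat.mul_pos hd₂pos hu₂pos) h3
    have : Nat.Coprime k y := (hcy.coprime_dvd_right ⟨u₂, by rw [hk]; ring⟩).symm
    exact this.dvd_of_dvd_mul_right h4
  have hij : 0 < i + j := by
    rcases Nat.eq_zero_or_pos (i + j) with h0 | h0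
    · have : i = 0 ∧ j = 0 := by omega
      simp [this.1, this.2] at hpos
    · exact h0
  have hkle : k ≤ i + j := Nat.le_of_dvd hij hkij
  obtain ⟨i', j', hi', hj', hsum⟩ : ∃ i' j', i' ≤ i ∧ j' ≤ j ∧ i' + j' = k :=
    ⟨min i k, k - min i k, by omega, by omega, by omega⟩
  have hdvd : b ∣ (u₁ * i') * α₁ + (u₂ * j') * α₂ := by
    rw [← Nat.modEq_zero_iff_dvd]
    calc (u₁ * i') * α₁ + (u₂ * j') * α₂ = i' * (α₁ * u₁) + j' * (α₂ * u₂) := by ring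
      _ ≡ i' * (α₂ * u₂) + j' * (α₂ * u₂) [MOD b] := (Nat.ModEq.mul_left i' hcong).add_right _
      _ = b * y := by rw [hbk, ← hsum, hy]; ring
      _ ≡ 0 [MOD b] := (Nat.modEq_zero_iff_dvd).2 (dvd_mul_right _ _)
  obtain ⟨v', hv'⟩ := hdvd
  have hi := Nat.mul_le_mul_left u₁ hi'
  have hj := Nat.mul_le_mul_left u₂ hj'
  refine ⟨u₁ * i', u₂ * j', v', hi, hj, ?_, by rw [hv']; ring, ?_⟩
  · refine Nat.le_of_mul_le_mul_left ?_ hb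
    rw [← hv', mul_comm b v, ← h]
    gcongr
  · rw [hbk, ← hsum, hu₁, hu₂]; ring

end Arithmetic

/-! ### Factorizations read as sequences of letters. -/

section Content

variable {H P : Type*} [CommMonoid H]

/-- The product of a factorization, computed in the free monoid over `P`. -/
def content (θ : Associates H →* FreeMon P) (z : Factorization H) : Multiset P :=
  (z.map fun u : Atom H => Multiplicative.toAdd (θ u)).sum

/-- The sum of the weights of a sequence. -/
def weight (w : P → ℤ) (S : Multiset P) : ℤ := (S.map w).sum

@[simp] theorem weight_zero (w : P → ℤ) : weight w 0 = 0 := by simp [weight]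

@[simp] theorem weight_add (w : P → ℤ) (S T : Multiset P) :
    weight w (S + T) = weight w S + weight w T := by simp [weight]

@[simp] theorem weight_replicate (w : P → ℤ) (n : ℕ) (p : P) :
    weight w (Multiset.replicate n p) = n * w p := by simp [weight]

variable (θ : Associates H →* FreeMon P)

@[simp] theorem content_zero : content θ 0 = 0 := by simp [content]

@[simp] theorem content_add (z z' : Factorization H) :
    content θ (z + z') = content θ z + content θ z' := by simp [content]

@[simp] theorem content_nsmul (n : ℕ) (z : Factorization H) :
    content θ (n • z) = n • content θ z := by
  simp [content, Multiset.map_nsmul, Multiset.sum_nsmul]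

theorem content_eq_toAdd_eval (z : Factorization H) :
    content θ z = Multiplicative.toAdd (θ z.eval) := by
  induction z using Multiset.induction_on with
  | empty => simp [content, Factorization.eval]
  | cons u z ih =>
    simp only [content, Factorization.eval, Multiset.map_cons, Multiset.sum_cons,
      Multiset.prod_cons, map_mul, toAdd_mul] at ih ⊢
    rw [ih]

theorem le_content_of_mem {z : Factorization H} {u : Atom H} (hu : u ∈ z) :
    Multiplicative.toAdd (θ u) ≤ content θ z :=
  Multiset.le_sum_of_mem
    (Multiset.mem_map_of_mem (fun u : Atom H => Multiplicative.toAdd (θ u)) hu)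

variable {θ} {w : P → ℤ}

theorem mem_factorizations_iff (hinj : Function.Injective θ) {a : H} {z : Factorization H} :
    z ∈ factorizations a ↔ content θ z = Multiplicative.toAdd (θ (Associates.mk a)) := by
  rw [content_eq_toAdd_eval]
  exact ⟨fun h => by rw [show z.eval = _ from h], fun h => hinj (Multiplicative.toAdd.injective h)⟩

theorem isUnit_iff_map_eq_one (hinj : Function.Injective θ) (x : Associates H) :
    IsUnit x ↔ Multiplicative.toAdd (θ x) = 0 := by
  rw [Associates.isUnit_iff_eq_one, ← map_eq_one_iff θ hinj]
  rfl

/-- An atom has no nontrivial zero-sum subsequences. -/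
theorem eq_zero_or_eq_of_le_atom (hinj : Function.Injective θ)
    (hrange : ∀ S : Multiset P, (∃ x, Multiplicative.toAdd (θ x) = S) ↔ weight w S = 0)
    (u : Atom H) {S : Multiset P} (hle : S ≤ Multiplicative.toAdd (θ u)) (hS : weight w S = 0) :
    S = 0 ∨ S = Multiplicative.toAdd (θ u) := by
  obtain ⟨T, hT⟩ := Multiset.le_iff_exists_add.1 hle
  have hu : weight w (Multiplicative.toAdd (θ u)) = 0 := (hrange _).1 ⟨u, rfl⟩
  have hT0 : weight w T = 0 := by simpa [hT, hS] using hu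
  obtain ⟨x, hx⟩ := (hrange S).2 hS
  obtain ⟨y, hy⟩ := (hrange T).2 hT0
  have hxy : (u : Associates H) = x * y := by
    apply hinj
    apply Multiplicative.toAdd.injective
    rw [hT, map_mul, toAdd_mul, hx, hy]
  rcases u.2.isUnit_or_isUnit hxy with h | h
  · left; rwa [isUnit_iff_map_eq_one hinj, hx] at h
  · right; rw [isUnit_iff_map_eq_one hinj, hy] at h; rw [hT, h, add_zero]

/-- Nonunits have nonempty content, so splitting a reducible element gives strictly shorter
sequences and induction on the length applies. -/
theorem exists_content_eq (hinj : Function.Injective θ)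
    (hrange : ∀ S : Multiset P, (∃ x, Multiplicative.toAdd (θ x) = S) ↔ weight w S = 0)
    {S : Multiset P} (hS : weight w S = 0) : ∃ z : Factorization H, content θ z = S := by
  induction hn : S.card using Nat.strong_induction_on generalizing S with
  | _ n ih =>
  obtain ⟨x, hx⟩ := (hrange S).2 hS
  by_cases h0 : S = 0
  · exact ⟨0, by simp [h0]⟩
  by_cases hirr : Irreducible x
  · exact ⟨{⟨x, hirr⟩}, by simp [content, hx]⟩
  have hxu : ¬ IsUnit x := by rwa [isUnit_iff_map_eq_one hinj, hx]
  rw [irreducible_iff] at hirr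
  push Not at hirr
  obtain ⟨y, y', rfl, hy, hy'⟩ := hirr hxu
  rw [isUnit_iff_map_eq_one hinj] at hy hy'
  rw [map_mul, toAdd_mul] at hx
  have hc : (Multiplicative.toAdd (θ y)).card + (Multiplicative.toAdd (θ y')).card = n := by
    rw [← hn, ← hx, Multiset.card_add]
  have c1 := Multiset.card_pos.2 hy
  have c2 := Multiset.card_pos.2 hy'
  obtain ⟨z, hz⟩ := ih _ (by omega) ((hrange _).1 ⟨y, rfl⟩) rfl
  obtain ⟨z', hz'⟩ := ih _ (by omega) ((hrange _).1 ⟨y', rfl⟩) rfl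
  exact ⟨z + z', by rw [content_add, hz, hz', hx]⟩

theorem atom_ne_zero (hinj : Function.Injective θ) (u : Atom H) :
    Multiplicative.toAdd (θ u) ≠ 0 := fun h =>
  u.2.not_isUnit ((isUnit_iff_map_eq_one hinj _).2 h)

end Content

/-! ### Consequences of a bounded tame degree. -/

section TameDegree

variable {H : Type*} [CommMonoid H]

/-- A finite bound on the tame degree yields a nearby factorization. -/
theorem exists_dist_le_of_tameDegree_le {a : H} {x : Factorization H} {N : ℕ}
    (h : tameDegree a x ≤ N) (hx : ∃ y ∈ factorizations a, x ≤ y) {z : Factorization H}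
    (hz : z ∈ factorizations a) : ∃ z' ∈ factorizations a, x ≤ z' ∧ dist z z' ≤ N := by
  -- `⊤` belongs to the set, so it is nonempty and its infimum is attained.
  have hmem := csInf_mem (s := {N : ℕ∞ | (∃ y ∈ factorizations a, x ≤ y) →
    ∀ z ∈ factorizations a, ∃ z' ∈ factorizations a, x ≤ z' ∧ (dist z z' : ℕ∞) ≤ N})
    ⟨⊤, fun ⟨y, hy, hxy⟩ z _ => ⟨y, hy, hxy, le_top⟩⟩
  obtain ⟨z', h1, h2, h3⟩ := hmem hx z hz
  exact ⟨z', h1, h2, by exact_mod_cast h3.trans h⟩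

theorem tameDegree_le_of_mem {a : H} {x : Factorization H} {X : Set (Factorization H)}
    (hx : x ∈ X) : tameDegree a x ≤ tameDegreeSet a X :=
  le_iSup₂ (f := fun x (_ : x ∈ X) => tameDegree a x) x hx

/-- An additive function bounded by `B` on the atoms of `z` drops by at most `B` times the
distance when one passes from `z` to `z'`. -/
theorem sum_map_le_add_mul_dist (f : Atom H → ℕ) {z z' : Factorization H} {B : ℕ}
    (hB : ∀ u ∈ z, f u ≤ B) : (z.map f).sum ≤ (z'.map f).sum + B * dist z z' := by
  classical
  have h1 : z = (z - z ∩ z') + z ∩ z' := (tsub_add_cancel_of_le Multiset.inter_le_left).symm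
  have h2 : (z.map f).sum = ((z - z ∩ z').map f).sum + ((z ∩ z').map f).sum := by
    conv_lhs => rw [h1]
    rw [Multiset.map_add, Multiset.sum_add]
  have h3 : ((z ∩ z').map f).sum ≤ (z'.map f).sum := by
    obtain ⟨y, hy⟩ := Multiset.le_iff_exists_add.1 (Multiset.inter_le_right (s := z) (t := z'))
    conv_rhs => rw [hy]
    rw [Multiset.map_add, Multiset.sum_add]
    exact Nat.le_add_right _ _
  have h4 : ((z - z ∩ z').map f).sum ≤ (z - z ∩ z').card * B := by
    have := Multiset.sum_le_card_nsmul ((z - z ∩ z').map f) B (by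
      intro n hn
      obtain ⟨u, hu, rfl⟩ := Multiset.mem_map.1 hn
      exact hB u (Multiset.mem_of_le tsub_le_self hu))
    simpa using this
  have h5 : (z - z ∩ z').card ≤ dist z z' := by
    unfold dist
    convert le_max_left _ _
  have h6 := Nat.mul_le_mul_right B h5
  rw [mul_comm B]
  omega

end TameDegree

/-! ### Sequences over four letters, and half-factoriality without `r`. -/

section Words

variable {H P : Type*} [CommMonoid H]

/-- The sequence `r ^ n * p₁ ^ s * p₂ ^ t * q ^ v`. -/
def word (r p₁ p₂ q : P) (n s t v : ℕ) : Multiset P :=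
  Multiset.replicate n r + Multiset.replicate s p₁ + Multiset.replicate t p₂ +
    Multiset.replicate v q

theorem mem_of_mem_word {r p₁ p₂ q : P} {n s t v : ℕ} {x : P} (hx : x ∈ word r p₁ p₂ q n s t v) :
    x = r ∨ x = p₁ ∨ x = p₂ ∨ x = q := by
  simp only [word, Multiset.mem_add, Multiset.mem_replicate] at hx
  tauto

theorem word_add (r p₁ p₂ q : P) (n s t v n' s' t' v' : ℕ) :
    word r p₁ p₂ q n s t v + word r p₁ p₂ q n' s' t' v' =
      word r p₁ p₂ q (n + n') (s + s') (t + t') (v + v') := by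
  simp only [word, Multiset.replicate_add]
  abel

theorem nsmul_word (r p₁ p₂ q : P) (k n s t v : ℕ) :
    k • word r p₁ p₂ q n s t v = word r p₁ p₂ q (k * n) (k * s) (k * t) (k * v) := by
  simp only [word, nsmul_add, Multiset.nsmul_replicate]

theorem word_le_word {r p₁ p₂ q : P} {n s t v n' s' t' v' : ℕ} (hn : n ≤ n') (hs : s ≤ s')
    (ht : t ≤ t') (hv : v ≤ v') : word r p₁ p₂ q n s t v ≤ word r p₁ p₂ q n' s' t' v' := by
  unfold word
  gcongr

/-- Four letters `r, p₁, p₂, q` of weights `c, -α₁, -α₂, b`. -/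
structure Letters (w : P → ℤ) (r p₁ p₂ q : P) (c α₁ α₂ b : ℕ) : Prop where
  weight_r : w r = c
  weight_p₁ : w p₁ = -α₁
  weight_p₂ : w p₂ = -α₂
  weight_q : w q = b
  c_pos : 0 < c
  α₁_pos : 0 < α₁
  α₂_pos : 0 < α₂
  b_pos : 0 < b
  b_ne_c : b ≠ c
  p₁_ne_p₂ : p₁ ≠ p₂

namespace Letters

variable {w : P → ℤ} {r p₁ p₂ q : P} {c α₁ α₂ b : ℕ}

/-- With `Balanced.swap`, this lets bounds proved for `p₂` be reused for `p₁`. -/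
theorem swap (h : Letters w r p₁ p₂ q c α₁ α₂ b) : Letters w r p₂ p₁ q c α₂ α₁ b :=
  ⟨h.1, h.3, h.2, h.4, h.5, h.7, h.6, h.8, h.9, h.10.symm⟩

theorem r_ne_p₁ (h : Letters w r p₁ p₂ q c α₁ α₂ b) : r ≠ p₁ := by
  intro e; have h1 := h.weight_r; have := h.weight_p₁; have := h.c_pos; have := h.α₁_pos
  rw [e] at h1; omega

theorem q_ne_p₁ (h : Letters w r p₁ p₂ q c α₁ α₂ b) : q ≠ p₁ := by
  intro e; have h1 := h.weight_q; have := h.weight_p₁; have := h.b_pos; have := h.α₁_pos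
  rw [e] at h1; omega

theorem r_ne_q (h : Letters w r p₁ p₂ q c α₁ α₂ b) : r ≠ q := by
  intro e; have h1 := h.weight_r; have := h.weight_q; have := h.b_ne_c
  rw [e] at h1; omega

theorem weight_word (h : Letters w r p₁ p₂ q c α₁ α₂ b) (n s t v : ℕ) :
    weight w (word r p₁ p₂ q n s t v) = n * c - s * α₁ - t * α₂ + v * b := by
  simp only [word, weight_add, weight_replicate, h.weight_r, h.weight_p₁, h.weight_p₂, h.weight_q]
  ring

open Classical in
theorem count_word (h : Letters w r p₁ p₂ q c α₁ α₂ b) (n s t v : ℕ) :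
    (word r p₁ p₂ q n s t v).count r = n ∧ (word r p₁ p₂ q n s t v).count p₁ = s ∧
    (word r p₁ p₂ q n s t v).count p₂ = t ∧ (word r p₁ p₂ q n s t v).count q = v := by
  have h1 := h.r_ne_p₁
  have h2 := h.swap.r_ne_p₁
  have h3 := h.q_ne_p₁
  have h4 := h.swap.q_ne_p₁
  have h5 := h.r_ne_q
  have h6 := h.p₁_ne_p₂
  simp [word, Multiset.count_replicate, h1, h2, h3, h4, h5, h6, h1.symm, h2.symm, h3.symm,
    h4.symm, h5.symm, h6.symm]

open Classical in
theorem eq_word (h : Letters w r p₁ p₂ q c α₁ α₂ b) {S : Multiset P}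
    (hS : ∀ x ∈ S, x = r ∨ x = p₁ ∨ x = p₂ ∨ x = q) :
    S = word r p₁ p₂ q (S.count r) (S.count p₁) (S.count p₂) (S.count q) := by
  obtain ⟨h1, h2, h3, h4⟩ := h.count_word (S.count r) (S.count p₁) (S.count p₂) (S.count q)
  ext x
  by_cases hx : x = r ∨ x = p₁ ∨ x = p₂ ∨ x = q
  · rcases hx with rfl | rfl | rfl | rfl
    · exact h1.symm
    · exact h2.symm
    · exact h3.symm
    · exact h4.symm
  · rw [Multiset.count_eq_zero_of_notMem fun hm => hx (hS x hm),
      Multiset.count_eq_zero_of_notMem fun hm => hx (mem_of_mem_word hm)]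

open Classical in
theorem weight_eq (h : Letters w r p₁ p₂ q c α₁ α₂ b) {S : Multiset P}
    (hS : ∀ x ∈ S, x = r ∨ x = p₁ ∨ x = p₂ ∨ x = q) :
    weight w S = S.count r * c - S.count p₁ * α₁ - S.count p₂ * α₂ + S.count q * b := by
  conv_lhs => rw [h.eq_word hS]
  exact h.weight_word _ _ _ _

end Letters

open Classical in
theorem count_content (θ : Associates H →* FreeMon P) (p : P) (z : Factorization H) :
    (content θ z).count p = (z.map fun u : Atom H => (Multiplicative.toAdd (θ u)).count p).sum := by
  induction z using Multiset.induction_on with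
  | empty => simp
  | cons u z ih =>
    have : content θ (u ::ₘ z) = Multiplicative.toAdd (θ u) + content θ z := by simp [content]
    rw [this, Multiset.count_add, ih, Multiset.map_cons, Multiset.sum_cons]

variable {θ : Associates H →* FreeMon P} {w : P → ℤ} {r p₁ p₂ q : P} {c α₁ α₂ b : ℕ}

namespace Letters

/-- The congruence making sequences over `{p₁, p₂, q}` half-factorial. -/
def Balanced (α₁ α₂ b : ℕ) : Prop :=
  α₁ * (α₂.gcd b / (α₁.gcd b).gcd (α₂.gcd b)) ≡
    α₂ * (α₁.gcd b / (α₁.gcd b).gcd (α₂.gcd b)) [MOD b]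

theorem Balanced.swap (h : Balanced α₁ α₂ b) : Balanced α₂ α₁ b := by
  unfold Balanced at *
  rw [Nat.gcd_comm (α₂.gcd b)]
  exact h.symm

variable (h : Letters w r p₁ p₂ q c α₁ α₂ b) (hinj : Function.Injective θ)
  (hrange : ∀ S : Multiset P, (∃ x, Multiplicative.toAdd (θ x) = S) ↔ weight w S = 0)

include h hinj hrange

-- An `r`-free atom contains a zero-sum part of norm `b` by `exists_zeroSum_le_of_modEq`, and
-- minimality makes that part the whole atom.
open Classical in
theorem atom_norm (hbal : Balanced α₁ α₂ b) (u : Atom H)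
    (hu : ∀ x ∈ Multiplicative.toAdd (θ u), x = r ∨ x = p₁ ∨ x = p₂ ∨ x = q)
    (hr : r ∉ Multiplicative.toAdd (θ u)) :
    α₁.gcd b * (Multiplicative.toAdd (θ u)).count p₁ +
      α₂.gcd b * (Multiplicative.toAdd (θ u)).count p₂ = b := by
  have hw : weight w (Multiplicative.toAdd (θ u)) = 0 := (hrange _).1 ⟨u, rfl⟩
  have hS := h.eq_word hu
  have hne := atom_ne_zero hinj u
  have hmin := fun S => eq_zero_or_eq_of_le_atom hinj hrange u (S := S)
  generalize Multiplicative.toAdd (θ u) = T at *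
  rw [h.weight_eq hu, Multiset.count_eq_zero_of_notMem hr] at hw
  rw [Multiset.count_eq_zero_of_notMem hr] at hS
  have hw' : T.count p₁ * α₁ + T.count p₂ * α₂ = T.count q * b := by
    push_cast at hw; zify; linarith
  -- With neither `p₁` nor `p₂`, weight zero would exclude `q` too and leave the empty sequence.
  have hpos : 0 < T.count p₁ + T.count p₂ := by
    by_contra h0
    have h1 : T.count p₁ = 0 := by omega
    have h2 : T.count p₂ = 0 := by omega
    have h3 : T.count q = 0 := by
      rw [h1, h2] at hw'
      have := h.b_pos
      simp at hw'
      rcases hw' with h' | h'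
      · exact Multiset.count_eq_zero.2 h'
      · omega
    rw [h1, h2, h3] at hS
    exact hne (by simpa [word] using hS)
  obtain ⟨s, t, v, hs, ht, hv, hsum, hnorm⟩ :=
    exists_zeroSum_le_of_modEq h.b_pos hbal hw' hpos
  have hle : word r p₁ p₂ q 0 s t v ≤ T := by
    rw [hS]; exact word_le_word le_rfl hs ht hv
  have hc := h.count_word 0 s t v
  rcases hmin _ hle (by rw [h.weight_word]; zify at hsum; push_cast; linarith) with h0 | h0
  · rw [h0] at hc
    have := h.b_pos
    simp only [Multiset.count_zero] at hc
    rw [← hc.2.1, ← hc.2.2.1] at hnorm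
    simp at hnorm
    omega
  · rw [h0] at hc
    rw [hc.2.1, hc.2.2.1, hnorm]

open Classical in
/-- Sequences over `{p₁, p₂, q}` have a unique factorization length. -/
theorem card_mul_eq (hbal : Balanced α₁ α₂ b) {z : Factorization H}
    (hz : ∀ x ∈ content θ z, x = r ∨ x = p₁ ∨ x = p₂ ∨ x = q) (hr : r ∉ content θ z) :
    z.card * b = α₁.gcd b * (content θ z).count p₁ + α₂.gcd b * (content θ z).count p₂ := by
  rw [count_content, count_content, ← Multiset.sum_map_mul_left, ← Multiset.sum_map_mul_left,
    ← Multiset.sum_map_add, Multiset.map_congr rfl (g := fun _ => b)]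
  · simp
  · intro u hu
    have hle := Multiset.subset_of_le (le_content_of_mem θ hu)
    exact h.atom_norm hinj hrange hbal u (fun x hx => hz x (hle hx)) (fun hx => hr (hle hx))

open Classical in
/-- Every atom over `{r, p₁, p₂}` contains `r`. -/
theorem card_le_of_notMem {z : Factorization H}
    (hz : ∀ x ∈ content θ z, x = r ∨ x = p₁ ∨ x = p₂ ∨ x = q) (hq : q ∉ content θ z) :
    z.card ≤ (content θ z).count r := by
  rw [count_content]
  -- Without `r` and `q` all weights are negative, so only the empty sequence has weight zero.
  have key : ∀ n ∈ z.map fun u : Atom H => (Multiplicative.toAdd (θ u)).count r, 1 ≤ n := by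
    intro n hn
    obtain ⟨u, hu, rfl⟩ := Multiset.mem_map.1 hn
    have hle := Multiset.subset_of_le (le_content_of_mem θ hu)
    have hu' : ∀ x ∈ Multiplicative.toAdd (θ u), x = r ∨ x = p₁ ∨ x = p₂ ∨ x = q :=
      fun x hx => hz x (hle hx)
    have hq' : q ∉ Multiplicative.toAdd (θ u) := fun hx => hq (hle hx)
    have hw : weight w (Multiplicative.toAdd (θ u)) = 0 := (hrange _).1 ⟨u, rfl⟩
    by_contra hlt
    have hr : (Multiplicative.toAdd (θ u)).count r = 0 := by omega
    have hS := h.eq_word hu'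
    rw [h.weight_eq hu', hr, Multiset.count_eq_zero_of_notMem hq'] at hw
    have hw' : (Multiplicative.toAdd (θ u)).count p₁ * α₁ +
        (Multiplicative.toAdd (θ u)).count p₂ * α₂ = 0 := by
      push_cast at hw; zify; linarith
    have e1 : (Multiplicative.toAdd (θ u)).count p₁ = 0 :=
      (Nat.mul_eq_zero.1 (by omega)).resolve_right h.α₁_pos.ne'
    have e2 : (Multiplicative.toAdd (θ u)).count p₂ = 0 :=
      (Nat.mul_eq_zero.1 (by omega)).resolve_right h.α₂_pos.ne'
    rw [hr, e1, e2, Multiset.count_eq_zero_of_notMem hq'] at hS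
    exact atom_ne_zero hinj u (by simpa [word] using hS)
  simpa using Multiset.card_nsmul_le_sum key

end Letters

end Words

/-! ### Large tame degrees and the failure of tame generation. -/

section NotTame

variable {H P : Type*} [CommMonoid H] {θ : Associates H →* FreeMon P} {w : P → ℤ}
  {r p₁ p₂ q : P} {c α₁ α₂ b : ℕ}

namespace Letters

variable (h : Letters w r p₁ p₂ q c α₁ α₂ b) (hinj : Function.Injective θ)
  (hrange : ∀ S : Multiset P, (∃ x, Multiplicative.toAdd (θ x) = S) ↔ weight w S = 0)

include h hinj hrange

open Classical in
/-- If `a` has a factorization in which the atoms containing `r` do not contain `p₂`, then a bound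
on the tame degree bounds the multiplicity of `p₂` in the atoms containing `r`. -/
theorem count_le_of_tameDegreeSet_le (hbal : Balanced α₁ α₂ b) {a e : H} (hea : e ∣ a)
    (ha : ∀ x ∈ Multiplicative.toAdd (θ (Associates.mk a)), x = r ∨ x = p₁ ∨ x = p₂ ∨ x = q)
    {N : ℕ} (hN : tameDegreeSet a (factorizations e) ≤ N) {z : Factorization H}
    (hz : z ∈ factorizations a)
    (hzr : ∀ u ∈ z, r ∈ Multiplicative.toAdd (θ (u : Associates H)) →
      p₂ ∉ Multiplicative.toAdd (θ (u : Associates H)))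
    {x : Factorization H} (hx : x ∈ factorizations e) {X : Atom H} (hX : X ∈ x)
    (hrX : r ∈ Multiplicative.toAdd (θ X)) :
    (Multiplicative.toAdd (θ X)).count p₂ ≤ b * N := by
  have hex : ∃ y ∈ factorizations a, x ≤ y := by
    obtain ⟨f, rfl⟩ := hea
    obtain ⟨y, hy⟩ := exists_content_eq hinj hrange ((hrange _).1 ⟨Associates.mk f, rfl⟩)
    refine ⟨x + y, ?_, Multiset.le_add_right _ _⟩
    rw [mem_factorizations_iff hinj] at hx ⊢
    rw [content_add, hx, hy, Associates.mk_mul_mk.symm, map_mul, toAdd_mul]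
  obtain ⟨z', hz', hxz', hd⟩ :=
    exists_dist_le_of_tameDegree_le ((tameDegree_le_of_mem hx).trans hN) hex hz
  let val : Atom H → Multiset P := fun u => Multiplicative.toAdd (θ (u : Associates H))
  -- `f` and `g` split the multiplicity of `p₂` between `r`-free atoms and atoms with `r`. Their
  -- total is fixed by `a`; `g` vanishes on `z` but is at least the multiplicity in `X` on `z'`, so
  -- `f` must drop by that amount.
  let f : Atom H → ℕ := fun u => if r ∈ val u then 0 else (val u).count p₂
  let g : Atom H → ℕ := fun u => if r ∈ val u then (val u).count p₂ else 0
  have hfg : ∀ y : Factorization H, (content θ y).count p₂ = (y.map f).sum + (y.map g).sum := by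
    intro y
    rw [count_content, ← Multiset.sum_map_add]
    congr 1
    refine Multiset.map_congr rfl fun u _ => ?_
    simp only [f, g, val]
    split_ifs <;> simp
  have hgz : (z.map g).sum = 0 := by
    refine Multiset.sum_eq_zero fun n hn => ?_
    obtain ⟨u, hu, rfl⟩ := Multiset.mem_map.1 hn
    simp only [g, val]
    split_ifs with hr
    · exact Multiset.count_eq_zero_of_notMem (hzr u hu hr)
    · rfl
  have hgz' : (val X).count p₂ ≤ (z'.map g).sum := by
    have : g X = (val X).count p₂ := if_pos hrX
    rw [← this]
    exact Multiset.le_sum_of_mem (Multiset.mem_map_of_mem g (Multiset.mem_of_le hxz' hX))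
  have hfB : ∀ u ∈ z, f u ≤ b := by
    intro u hu
    simp only [f]
    split_ifs with hr
    · exact Nat.zero_le _
    · have hle := Multiset.subset_of_le (le_content_of_mem θ hu)
      rw [(mem_factorizations_iff hinj).1 hz] at hle
      have hn := h.atom_norm hinj hrange hbal u (fun x hx => ha x (hle hx)) hr
      have : 0 < α₂.gcd b := Nat.gcd_pos_of_pos_right _ h.b_pos
      have := Nat.le_mul_of_pos_left ((val u).count p₂) this
      simp only [val] at this ⊢
      omega
  have h1 := sum_map_le_add_mul_dist f (z' := z') hfB
  have h2 := hfg z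
  have h3 := hfg z'
  rw [(mem_factorizations_iff hinj).1 hz] at h2
  rw [(mem_factorizations_iff hinj).1 hz'] at h3
  have h4 := Nat.mul_le_mul_left b hd
  change (val X).count p₂ ≤ _
  omega

/-- If `a` has a factorization separating `r` from `p₂` and one separating `r` from `p₁`, then the
tame degree of `a` with respect to any divisor containing `r` is large. -/
theorem le_of_tameDegreeSet_le (hbal : Balanced α₁ α₂ b) {a e : H} (hea : e ∣ a)
    (ha : ∀ x ∈ Multiplicative.toAdd (θ (Associates.mk a)), x = r ∨ x = p₁ ∨ x = p₂ ∨ x = q)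
    {N : ℕ} (hN : tameDegreeSet a (factorizations e) ≤ N) {z₁ z₂ : Factorization H}
    (hz₁ : z₁ ∈ factorizations a)
    (hzr₁ : ∀ u ∈ z₁, r ∈ Multiplicative.toAdd (θ (u : Associates H)) →
      p₂ ∉ Multiplicative.toAdd (θ (u : Associates H)))
    (hz₂ : z₂ ∈ factorizations a)
    (hzr₂ : ∀ u ∈ z₂, r ∈ Multiplicative.toAdd (θ (u : Associates H)) →
      p₁ ∉ Multiplicative.toAdd (θ (u : Associates H)))
    (hre : r ∈ Multiplicative.toAdd (θ (Associates.mk e))) :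
    c ≤ b * N * (α₁ + α₂) := by
  classical
  obtain ⟨x, hx⟩ := exists_content_eq hinj hrange ((hrange _).1 ⟨Associates.mk e, rfl⟩)
  have hxe : x ∈ factorizations e := (mem_factorizations_iff hinj).2 hx
  obtain ⟨X, hX, hrX⟩ : ∃ X ∈ x, r ∈ Multiplicative.toAdd (θ (X : Associates H)) := by
    rw [← hx] at hre
    exact Multiset.mem_bind.1
      (show r ∈ x.bind fun u : Atom H => Multiplicative.toAdd (θ u) from hre)
  have h2 := h.count_le_of_tameDegreeSet_le hinj hrange hbal hea ha hN hz₁ hzr₁ hxe hX hrX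
  have h1 := h.swap.count_le_of_tameDegreeSet_le hinj hrange hbal.swap hea
    (fun x hx => by have := ha x hx; tauto) hN hz₂ hzr₂ hxe hX hrX
  have hle : Multiplicative.toAdd (θ (X : Associates H)) ≤
      Multiplicative.toAdd (θ (Associates.mk a)) := by
    obtain ⟨f, rfl⟩ := hea
    rw [Associates.mk_mul_mk.symm, map_mul, toAdd_mul, ← hx]
    exact (le_content_of_mem θ hX).trans (Multiset.le_add_right _ _)
  have hw : weight w (Multiplicative.toAdd (θ (X : Associates H))) = 0 := (hrange _).1 ⟨X, rfl⟩
  rw [h.weight_eq fun x hx => ha x (Multiset.mem_of_le hle hx)] at hw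
  have hr1 : 1 ≤ (Multiplicative.toAdd (θ (X : Associates H))).count r :=
    Multiset.one_le_count_iff_mem.2 hrX
  generalize Multiplicative.toAdd (θ (X : Associates H)) = T at *
  -- As `X` contains `r`, its negative letters must compensate a weight of at least `c`.
  have hw' : T.count r * c + T.count q * b = T.count p₁ * α₁ + T.count p₂ * α₂ := by
    zify; linarith
  have e1 := Nat.mul_le_mul_right α₁ h1
  have e2 := Nat.mul_le_mul_right α₂ h2
  have e3 := Nat.mul_le_mul_right c hr1
  rw [mul_add]
  omega

theorem exists_factorization_word {n s t v : ℕ}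
    (hw : n * c + v * b = s * α₁ + t * α₂) :
    ∃ z : Factorization H, content θ z = word r p₁ p₂ q n s t v := by
  refine exists_content_eq hinj hrange ?_
  rw [h.weight_word]
  zify at hw
  linarith

/-- For large `c` there is an element with two factorizations of nearby, distinct lengths that also
has factorizations separating `r` from `p₂` and from `p₁`. -/
theorem exists_element (hbal : Balanced α₁ α₂ b) (hne : α₁ * α₂.gcd b ≠ α₂ * α₁.gcd b)
    (hc : b * α₂ * α₁ ≤ c) : ∃ (a : H) (z₁ z₂ y : Factorization H),
      z₁ ∈ factorizations a ∧ z₂ ∈ factorizations a ∧ y ∈ factorizations a ∧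
      (∀ x ∈ Multiplicative.toAdd (θ (Associates.mk a)), x = r ∨ x = p₁ ∨ x = p₂ ∨ x = q) ∧
      (∀ u ∈ z₁, r ∈ Multiplicative.toAdd (θ (u : Associates H)) →
        p₂ ∉ Multiplicative.toAdd (θ (u : Associates H))) ∧
      (∀ u ∈ z₂, r ∈ Multiplicative.toAdd (θ (u : Associates H)) →
        p₁ ∉ Multiplicative.toAdd (θ (u : Associates H))) ∧
      z₁.card ≠ y.card ∧
      z₁.card ≤ y.card + α₁ * (1 + α₁ * b + α₂ * b) ∧
      y.card ≤ z₁.card + α₁ * (1 + α₁ * b + α₂ * b) := by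
  classical
  obtain ⟨c₀, hc₀⟩ := Nat.exists_eq_add_of_le hc
  have hb := h.b_pos
  have hα₁ := h.α₁_pos
  have hα₂ := h.α₂_pos
  obtain ⟨c₁, hc₁⟩ : ∃ c₁, c = α₁ + c₁ :=
    Nat.exists_eq_add_of_le ((Nat.le_mul_of_pos_left α₁ (Nat.mul_pos hb hα₂)).trans hc)
  obtain ⟨k, hk⟩ : ∃ k, α₂ * b = k + 1 :=
    ⟨α₂ * b - 1, by have := Nat.mul_pos hα₂ hb; omega⟩
  obtain ⟨f₁, hf₁⟩ := h.exists_factorization_word hinj hrange (n := α₁) (s := c) (t := 0) (v := 0)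
    (by ring)
  obtain ⟨f₂, hf₂⟩ := h.exists_factorization_word hinj hrange (n := α₂) (s := 0) (t := c) (v := 0)
    (by ring)
  -- `f` arises from `f₁` by trading `b α₂ α₁` letters `p₁` for `b α₁ α₁` letters `p₂` of the same
  -- total weight.
  obtain ⟨f, hf⟩ := h.exists_factorization_word hinj hrange (n := α₁) (s := c₀)
    (t := b * α₁ * α₁) (v := 0) (by rw [hc₀]; ring)
  obtain ⟨g₁, hg₁⟩ := h.exists_factorization_word hinj hrange (n := 0) (s := b) (t := 0)
    (v := α₁) (by ring)
  obtain ⟨g₂, hg₂⟩ := h.exists_factorization_word hinj hrange (n := 0) (s := 0) (t := b)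
    (v := α₂) (by ring)
  have hmem {z : Factorization H} {n s t v : ℕ} (hz : content θ z = word r p₁ p₂ q n s t v) :
      ∀ x ∈ content θ z, x = r ∨ x = p₁ ∨ x = p₂ ∨ x = q := by
    rw [hz]; exact fun x hx => mem_of_mem_word hx
  have hcount {z : Factorization H} {n s t v : ℕ} (hz : content θ z = word r p₁ p₂ q n s t v) :
      (content θ z).count r = n ∧ (content θ z).count p₁ = s ∧
      (content θ z).count p₂ = t ∧ (content θ z).count q = v := by
    rw [hz]; exact h.count_word n s t v
  have cg₁ : g₁.card = α₁.gcd b := by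
    have := h.card_mul_eq hinj hrange hbal (hmem hg₁)
      (Multiset.count_eq_zero.1 (hcount hg₁).1)
    rw [(hcount hg₁).2.1, (hcount hg₁).2.2.1, mul_zero, add_zero] at this
    exact Nat.eq_of_mul_eq_mul_right hb this
  have cg₂ : g₂.card = α₂.gcd b := by
    have := h.card_mul_eq hinj hrange hbal (hmem hg₂)
      (Multiset.count_eq_zero.1 (hcount hg₂).1)
    rw [(hcount hg₂).2.1, (hcount hg₂).2.2.1, mul_zero, zero_add] at this
    exact Nat.eq_of_mul_eq_mul_right hb this
  have hcard {z : Factorization H} {s t : ℕ} (hz : content θ z = word r p₁ p₂ q α₁ s t 0) :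
      1 ≤ z.card ∧ z.card ≤ α₁ := by
    constructor
    · refine Nat.pos_of_ne_zero fun h0 => ?_
      rw [Multiset.card_eq_zero] at h0
      have := (hcount hz).1
      rw [h0] at this
      simp at this
      omega
    · rw [← (hcount hz).1]
      exact h.card_le_of_notMem hinj hrange (hmem hz)
        (Multiset.count_eq_zero.1 (hcount hz).2.2.2)
  have cf₁ := hcard hf₁
  have cf := hcard hf
  let z₁ : Factorization H := (α₂ * b) • f₁ + (c * α₁) • g₂
  let z₂ : Factorization H := (α₁ * b) • f₂ + (c * α₂) • g₁
  -- Compared with `z₁`, one `f₁` becomes `f`; the `p₁` released form `α₂ α₁` copies of `g₁`, and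
  -- the `p₂` consumed come from `α₁²` copies of `g₂`.
  let y : Factorization H := k • f₁ + f + (α₂ * α₁) • g₁ + (α₁ * c₁) • g₂
  have hz₁ : content θ z₁ = word r p₁ p₂ q (α₁ * α₂ * b) (c * α₂ * b) (c * α₁ * b)
      (c * α₁ * α₂) := by
    simp only [z₁, content_add, content_nsmul, hf₁, hg₂, nsmul_word, word_add]
    congr 1 <;> ring
  have hz₂ : content θ z₂ = word r p₁ p₂ q (α₁ * α₂ * b) (c * α₂ * b) (c * α₁ * b)
      (c * α₁ * α₂) := by
    simp only [z₂, content_add, content_nsmul, hf₂, hg₁, nsmul_word, word_add]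
    congr 1 <;> ring
  have hy : content θ y = word r p₁ p₂ q (α₁ * α₂ * b) (c * α₂ * b) (c * α₁ * b)
      (c * α₁ * α₂) := by
    simp only [y, content_add, content_nsmul, hf₁, hf, hg₁, hg₂, nsmul_word, word_add]
    congr 1
    · calc _ = α₁ * (k + 1) := by ring
        _ = _ := by rw [← hk]; ring
    · calc _ = k * c + (b * α₂ * α₁ + c₀) := by ring
        _ = c * (k + 1) := by rw [← hc₀]; ring
        _ = _ := by rw [← hk]; ring
    · calc _ = (α₁ + c₁) * α₁ * b := by ring
        _ = _ := by rw [← hc₁]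
    · calc _ = (α₁ + c₁) * α₁ * α₂ := by ring
        _ = _ := by rw [← hc₁]
  obtain ⟨x, hx⟩ := (hrange (content θ z₁)).2 (by
    rw [hz₁, h.weight_word]; push_cast; ring)
  obtain ⟨a, rfl⟩ := Associates.mk_surjective x
  have hmemF {z : Factorization H} (hz : content θ z = content θ z₁) : z ∈ factorizations a := by
    rw [mem_factorizations_iff hinj, hz, hx]
  have card_z₁ : z₁.card = (k + 1) * f₁.card + c * α₁ * α₂.gcd b := by
    simp only [z₁, Multiset.card_add, Multiset.card_nsmul, cg₂, hk]
  have card_y : y.card = k * f₁.card + f.card + α₂ * α₁ * α₁.gcd b + α₁ * c₁ * α₂.gcd b := by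
    simp only [y, Multiset.card_add, Multiset.card_nsmul, cg₁, cg₂]
  have hdiff : (y.card : ℤ) - z₁.card =
      f.card - f₁.card + α₁ * (α₂ * α₁.gcd b - α₁ * α₂.gcd b) := by
    rw [card_y, card_z₁, hc₁]; push_cast; ring
  have hnotin {z : Factorization H} {p : P} (hp : (content θ z).count p = 0) {u : Atom H}
      (hu : u ∈ z) : p ∉ Multiplicative.toAdd (θ (u : Associates H)) := fun hpu =>
    Multiset.count_eq_zero.1 hp (Multiset.mem_of_le (le_content_of_mem θ hu) hpu)
  have hg₁b : α₁.gcd b ≤ b := Nat.gcd_le_right _ hb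
  have hg₂b : α₂.gcd b ≤ b := Nat.gcd_le_right _ hb
  refine ⟨a, z₁, z₂, y, hmemF rfl, hmemF (hz₂.trans hz₁.symm), hmemF (hy.trans hz₁.symm),
    ?_, ?_, ?_, ?_, ?_⟩
  · rw [hx]; exact hmem hz₁
  · intro u hu hr
    rcases Multiset.mem_add.1 hu with hu | hu
    · exact hnotin (hcount hf₁).2.2.1 (Multiset.mem_of_mem_nsmul hu)
    · exact absurd hr (hnotin (hcount hg₂).1 (Multiset.mem_of_mem_nsmul hu))
  · intro u hu hr
    rcases Multiset.mem_add.1 hu with hu | hu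
    · exact hnotin (hcount hf₂).2.1 (Multiset.mem_of_mem_nsmul hu)
    · exact absurd hr (hnotin (hcount hg₁).1 (Multiset.mem_of_mem_nsmul hu))
  -- `f` and `f₁` have lengths in `[1, α₁]`, so these differ by less than `α₁` and cannot cancel a
  -- nonzero multiple of `α₁`.
  · intro heq
    rw [heq, sub_self] at hdiff
    rcases lt_or_gt_of_ne hne with hlt | hlt
    · have : (1 : ℤ) ≤ α₂ * α₁.gcd b - α₁ * α₂.gcd b := by zify at hlt; omega
      have := mul_le_mul_of_nonneg_left this (Int.natCast_nonneg α₁)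
      omega
    · have : (α₂ * α₁.gcd b - α₁ * α₂.gcd b : ℤ) ≤ -1 := by zify at hlt; omega
      have := mul_le_mul_of_nonneg_left this (Int.natCast_nonneg α₁)
      omega
  · have e₁ := Nat.mul_le_mul_left α₁ (Nat.mul_le_mul_left α₂ hg₁b)
    have e₂ := Nat.mul_le_mul_left α₁ (Nat.mul_le_mul_left α₁ hg₂b)
    zify at e₁ e₂ cf cf₁ ⊢
    have e₃ : (0 : ℤ) ≤ α₁ * (α₂ * α₁.gcd b) := by positivity
    have e₄ : (0 : ℤ) ≤ α₁ * (α₁ * α₂.gcd b) := by positivity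
    constructor <;> linarith

/-- An element with two factorization lengths contains `r`. -/
theorem mem_of_card_ne (hbal : Balanced α₁ α₂ b) {e : H}
    (he : ∀ x ∈ Multiplicative.toAdd (θ (Associates.mk e)), x = r ∨ x = p₁ ∨ x = p₂ ∨ x = q)
    {z z' : Factorization H} (hz : z ∈ factorizations e) (hz' : z' ∈ factorizations e)
    (hne : z.card ≠ z'.card) : r ∈ Multiplicative.toAdd (θ (Associates.mk e)) := by
  classical
  by_contra hr
  rw [mem_factorizations_iff hinj] at hz hz'
  have h1 := h.card_mul_eq hinj hrange hbal (hz ▸ he) (hz ▸ hr)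
  have h2 := h.card_mul_eq hinj hrange hbal (hz' ▸ he) (hz' ▸ hr)
  rw [hz, ← hz', ← h2] at h1
  exact hne (Nat.eq_of_mul_eq_mul_right h.b_pos h1)

end Letters

/-- A monoid whose associated reduced monoid is the monoid of sequences of weight zero has a
pattern ideal that is not tamely generated, provided that there are letters of arbitrarily large
weight and suitable letters of weights `-α₁`, `-α₂` and `b`. -/
theorem exists_patternIdeal_not_tamelyGenerated (hinj : Function.Injective θ)
    (hrange : ∀ S : Multiset P, (∃ x, Multiplicative.toAdd (θ x) = S) ↔ weight w S = 0)
    (hα₁ : 0 < α₁) (hα₂ : 0 < α₂) (hb : 0 < b) (hp₁ : w p₁ = -α₁) (hp₂ : w p₂ = -α₂)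
    (hq : w q = b) (hbal : Letters.Balanced α₁ α₂ b) (hne : α₁ * α₂.gcd b ≠ α₂ * α₁.gcd b)
    (hinf : ∀ n : ℕ, ∃ p, (n : ℤ) < w p) :
    ∃ I : Set H, IsPatternIdeal I ∧ ¬ IsTamelyGenerated I := by
  by_contra! hall
  have key : ∀ D : ℕ, ∃ (E : Set H) (N : ℕ), 0 < N ∧
      IsTameGeneratingSet E (patternSet H {0, (D : ℤ)}) N :=
    fun D => hall _ ⟨{0, (D : ℤ)}, by simp, rfl⟩
  choose E N hN hE using key
  -- `B` does not involve `c`, so `M` bounds every relevant `N D` before `r` is chosen.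
  let B := α₁ * (1 + α₁ * b + α₂ * b)
  let M := ∑ D ∈ Finset.range (B + 1), N D
  -- The summands ensure, in turn, `b ≠ c`, the hypothesis of `exists_element`, and the final
  -- contradiction.
  obtain ⟨r, hr⟩ := hinf (b + b * α₂ * α₁ + b * M * (α₁ + α₂))
  obtain ⟨c, hc⟩ := Int.eq_ofNat_of_zero_le (a := w r) (by omega)
  rw [hc] at hr
  norm_cast at hr
  have h : Letters w r p₁ p₂ q c α₁ α₂ b :=
    ⟨hc, hp₁, hp₂, hq, by omega, hα₁, hα₂, hb, by omega, by
      rintro rfl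
      have : α₁ = α₂ := by omega
      exact hne (by rw [this])⟩
  obtain ⟨a, z₁, z₂, y, hz₁, hz₂, hy, ha, hs₁, hs₂, hcard, hB₁, hB₂⟩ :=
    h.exists_element hinj hrange hbal hne (by omega)
  obtain ⟨D, hD⟩ : ∃ D : ℕ, z₁.card = y.card + D ∨ y.card = z₁.card + D := by
    rcases le_total z₁.card y.card with hle | hle
    · obtain ⟨D, hD⟩ := Nat.exists_eq_add_of_le hle
      exact ⟨D, Or.inr hD⟩
    · obtain ⟨D, hD⟩ := Nat.exists_eq_add_of_le hle
      exact ⟨D, Or.inl hD⟩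
  have hDB : D ≤ B := by omega
  have hD0 : D ≠ 0 := by omega
  have haD : a ∈ patternSet H {0, (D : ℤ)} := by
    rcases hD with hD | hD
    · refine ⟨y.card, ?_⟩
      simp only [Finset.mem_insert, Finset.mem_singleton, forall_eq_or_imp, forall_eq, add_zero]
      exact ⟨⟨_, ⟨y, hy, rfl⟩, rfl⟩, ⟨_, ⟨z₁, hz₁, rfl⟩, by rw [hD]; push_cast; rfl⟩⟩
    · refine ⟨z₁.card, ?_⟩
      simp only [Finset.mem_insert, Finset.mem_singleton, forall_eq_or_imp, forall_eq, add_zero]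
      exact ⟨⟨_, ⟨z₁, hz₁, rfl⟩, rfl⟩, ⟨_, ⟨y, hy, rfl⟩, by rw [hD]; push_cast; rfl⟩⟩
  obtain ⟨e, heE, hea, -, het⟩ := (hE D).2 a haD
  obtain ⟨l, hl⟩ := (hE D).1 heE
  simp only [Finset.mem_insert, Finset.mem_singleton, forall_eq_or_imp, forall_eq, add_zero] at hl
  obtain ⟨⟨_, ⟨x, hx, rfl⟩, hxl⟩, ⟨_, ⟨x', hx', rfl⟩, hxl'⟩⟩ := hl
  have hle : Multiplicative.toAdd (θ (Associates.mk e)) ≤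
      Multiplicative.toAdd (θ (Associates.mk a)) := by
    obtain ⟨f, rfl⟩ := hea
    rw [Associates.mk_mul_mk.symm, map_mul, toAdd_mul]
    exact Multiset.le_add_right _ _
  have hre := h.mem_of_card_ne hinj hrange hbal
    (fun x hx => ha x (Multiset.mem_of_le hle hx)) hx hx' (by dsimp only at hxl hxl'; omega)
  have hcle := h.le_of_tameDegreeSet_le hinj hrange hbal hea ha het hz₁ hs₁ hz₂ hs₂ hre
  have hNM : N D ≤ M := Finset.single_le_sum (f := N) (fun _ _ => Nat.zero_le _)
    (Finset.mem_range.2 (Nat.lt_succ_of_le hDB))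
  have := Nat.mul_le_mul_right (α₁ + α₂) (Nat.mul_le_mul_left b hNM)
  omega

end NotTame

/-! ### From divisor homomorphisms and class groups to weights. -/

section DivisorHom

variable {H P : Type*} [CommMonoid H]

theorem FreeMon.eq_one_of_isUnit {x : FreeMon P} (hx : IsUnit x) : x = 1 := by
  obtain ⟨y, hy⟩ := isUnit_iff_exists_inv.1 hx
  have h : Multiplicative.toAdd x + Multiplicative.toAdd y = 0 := hy
  exact (add_eq_zero.1 h).1

/-- A homomorphism into a free monoid factors through the associated reduced monoid. -/
def reducedHom (φ : H →* FreeMon P) : Associates H →* FreeMon P where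
  toFun x := Quotient.liftOn x φ fun a b ⟨u, hu⟩ => by
    rw [← hu, map_mul, FreeMon.eq_one_of_isUnit (u.isUnit.map φ), mul_one]
  map_one' := map_one φ
  map_mul' x y := Quotient.inductionOn₂ x y fun a b => map_mul φ a b

@[simp] theorem reducedHom_mk (φ : H →* FreeMon P) (a : H) :
    reducedHom φ (Associates.mk a) = φ a := rfl

theorem reducedHom_injective [IsCancelMul H] {φ : H →* FreeMon P} (hdiv : IsDivisorHom φ) :
    Function.Injective (reducedHom φ) := by
  intro x y
  obtain ⟨a, rfl⟩ := Associates.mk_surjective x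
  obtain ⟨b, rfl⟩ := Associates.mk_surjective y
  simp only [reducedHom_mk]
  intro hab
  obtain ⟨c, rfl⟩ := hdiv a b (dvd_of_eq hab)
  obtain ⟨d, hd⟩ := hdiv (a * c) a (dvd_of_eq hab.symm)
  rw [mul_assoc] at hd
  have hcd : c * d = 1 := mul_eq_left.1 hd.symm
  exact Associates.mk_eq_mk_iff_associated.2
    ⟨⟨c, d, hcd, by rw [mul_comm, hcd]⟩, rfl⟩

/-- If the image of a divisor homomorphism `φ` consists of the sequences of weight zero and the
weights satisfy the arithmetic conditions, then some pattern ideal is not tamely generated. -/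
theorem exists_patternIdeal_of_divisorHom [IsCancelMul H] {φ : H →* FreeMon P}
    (hdiv : IsDivisorHom φ) {w : P → ℤ}
    (hrange : ∀ S : Multiset P, (∃ a, Multiplicative.toAdd (φ a) = S) ↔ weight w S = 0)
    (hinf : (Set.range w ∩ {g | 0 < g}).Infinite) {a₁ a₂ b : ℤ}
    (ha₁ : a₁ ∈ Set.range w) (ha₁neg : a₁ < 0) (ha₂ : a₂ ∈ Set.range w) (ha₂neg : a₂ < 0)
    (hb : b ∈ Set.range w) (hbpos : 0 < b)
    (hcong : a₁ * ((Int.gcd a₂ b / Int.gcd a₁ (Int.gcd a₂ b) : ℕ) : ℤ) ≡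
      a₂ * ((Int.gcd a₁ b / Int.gcd a₁ (Int.gcd a₂ b) : ℕ) : ℤ) [ZMOD b])
    (hne : a₁ * ((Int.gcd a₂ b / Int.gcd a₁ (Int.gcd a₂ b) : ℕ) : ℤ) ≠
      a₂ * ((Int.gcd a₁ b / Int.gcd a₁ (Int.gcd a₂ b) : ℕ) : ℤ)) :
    ∃ I : Set H, IsPatternIdeal I ∧ ¬ IsTamelyGenerated I := by
  obtain ⟨p₁, hp₁⟩ := ha₁
  obtain ⟨p₂, hp₂⟩ := ha₂
  obtain ⟨q, hq⟩ := hb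
  obtain ⟨α₁, hα₁⟩ := Int.eq_ofNat_of_zero_le (a := -a₁) (by omega)
  obtain ⟨α₂, hα₂⟩ := Int.eq_ofNat_of_zero_le (a := -a₂) (by omega)
  obtain ⟨b, rfl⟩ := Int.eq_ofNat_of_zero_le hbpos.le
  obtain rfl : a₁ = -α₁ := by omega
  obtain rfl : a₂ = -α₂ := by omega
  -- The three-term gcd is put in the form used by `Balanced`.
  have hgcd : α₁.gcd (α₂.gcd b) = (α₁.gcd b).gcd (α₂.gcd b) := by
    rw [Nat.gcd_assoc, Nat.gcd_comm b, Nat.gcd_eq_left (Nat.gcd_dvd_right α₂ b)]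
  simp only [Int.neg_gcd, Int.gcd_natCast_natCast, hgcd] at hcong hne
  have hbal : Letters.Balanced α₁ α₂ b := by
    unfold Letters.Balanced
    rw [← Int.natCast_modEq_iff]
    have := hcong.neg
    simpa only [neg_mul, neg_neg, Nat.cast_mul] using this
  refine exists_patternIdeal_not_tamelyGenerated (reducedHom_injective hdiv) (w := w)
    (fun S => ?_) (by omega) (by omega) (by omega) hp₁ hp₂ hq hbal ?_ ?_
  · rw [← hrange S]
    exact ⟨fun ⟨x, hx⟩ => by
      obtain ⟨a, rfl⟩ := Associates.mk_surjective x
      exact ⟨a, hx⟩, fun ⟨a, ha⟩ => ⟨Associates.mk a, ha⟩⟩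
  · intro heq
    apply hne
    rw [neg_mul, neg_mul, neg_inj]
    norm_cast
    rw [← Nat.mul_div_assoc _ (Nat.gcd_dvd_right _ _), heq,
      Nat.mul_div_assoc _ (Nat.gcd_dvd_left _ _)]
  · intro n
    by_contra! hle
    refine hinf ((Set.finite_Icc (0 : ℤ) n).subset ?_)
    rintro _ ⟨⟨p, rfl⟩, hp⟩
    exact ⟨le_of_lt hp, hle p⟩

/-- The class of `S` is trivial exactly when `S` lies in the image of the divisor homomorphism. -/
theorem classOf_eq_zero_iff {φ : H →* FreeMon P} (hdiv : IsDivisorHom φ) (S : FreeMon P) :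
    classOf φ S = 0 ↔ ∃ a, φ a = S := by
  have hof : Function.Injective (Algebra.GrothendieckGroup.of (M := FreeMon P)) :=
    Algebra.GrothendieckGroup.of_injective
  constructor
  · intro h
    have hmem : Algebra.GrothendieckGroup.of S ∈ imageQuotientGroup φ :=
      (QuotientGroup.eq_one_iff _).1 h
    -- Elements of the subgroup are fractions `φ u / φ v`; if `S` is one, then `φ v ∣ φ u`, and
    -- reflecting this divisibility to `H` puts `S` in the image.
    have key : ∀ x ∈ imageQuotientGroup φ, ∃ u v : H,
        x * Algebra.GrothendieckGroup.of (φ v) = Algebra.GrothendieckGroup.of (φ u) := by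
      intro x hx
      induction hx using Subgroup.closure_induction with
      | mem x hx =>
        obtain ⟨a, rfl⟩ := hx
        exact ⟨a, 1, by simp⟩
      | one => exact ⟨1, 1, by simp⟩
      | mul x y _ _ hx hy =>
        obtain ⟨u, v, huv⟩ := hx
        obtain ⟨u', v', huv'⟩ := hy
        refine ⟨u * u', v * v', ?_⟩
        simp only [map_mul]
        rw [← huv, ← huv']
        exact mul_mul_mul_comm _ _ _ _
      | inv x _ hx =>
        obtain ⟨u, v, huv⟩ := hx
        exact ⟨v, u, by rw [← huv, inv_mul_cancel_left]⟩
    obtain ⟨u, v, huv⟩ := key _ hmem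
    rw [← map_mul] at huv
    have huv := hof huv
    obtain ⟨t, rfl⟩ := hdiv v u ⟨S, by rw [← huv, mul_comm]⟩
    rw [map_mul, mul_comm] at huv
    exact ⟨t, (mul_left_cancel huv).symm⟩
  · rintro ⟨a, rfl⟩
    exact (QuotientGroup.eq_one_iff _).2 (Subgroup.subset_closure ⟨a, rfl⟩)

theorem map_classOf_eq_weight (φ : H →* FreeMon P) (ι : ClassGroup φ →+ ℤ) (S : Multiset P) :
    ι (classOf φ (Multiplicative.ofAdd S)) =
      weight (fun p => ι (classOf φ (FreeMon.of p))) S := by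
  have hmul : ∀ x y : FreeMon P, classOf φ (x * y) = classOf φ x + classOf φ y := by
    intro x y
    simp only [classOf, map_mul]
    rfl
  have hone : classOf φ (1 : FreeMon P) = 0 := by
    simp only [classOf, map_one]
    rfl
  induction S using Multiset.induction_on with
  | empty => rw [ofAdd_zero, hone, map_zero, weight_zero]
  | cons p S ih =>
    rw [← Multiset.singleton_add, ofAdd_add, hmul, map_add, ih, weight_add]
    simp [weight, FreeMon.of]

end DivisorHom

/-! ### Zero-sum sequences as an instance. -/

section ZeroSum

variable {G : Type*} [AddCommGroup G]

theorem isDivisorHom_zeroSumMonoid_subtype (G₀ : Set G) :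
    IsDivisorHom (zeroSumMonoid G₀).subtype := by
  rintro ⟨S, hS⟩ ⟨T, hT⟩ ⟨U, hU⟩
  have hU' : T = S * U := hU
  subst hU'
  refine ⟨⟨U, ?_⟩, rfl⟩
  have h1 : ((Multiplicative.toAdd S).map (fun g : G₀ => (g : G))).sum = 0 := hS
  have h2 : ((Multiplicative.toAdd (S * U)).map (fun g : G₀ => (g : G))).sum = 0 := hT
  rw [toAdd_mul, Multiset.map_add, Multiset.sum_add, h1, zero_add] at h2
  exact h2

end ZeroSum

end KrullFactorization

theorem proposition4p6
    {H : Type*} {P : Type*} [CancelCommMonoid H] (hH : KrullFactorization.IsKrullMonoid H)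
    (φ : H →* KrullFactorization.FreeMon P)
    (hdiv : KrullFactorization.IsDivisorHom φ) (hcof : KrullFactorization.IsCofinalHom φ)
    -- the class group is infinite cyclic and is identified with `ℤ` through `ι`
    (ι : KrullFactorization.ClassGroup φ ≃+ ℤ)
    -- the set of classes containing prime divisors, as a set of integers
    (GP : Set ℤ) (hGP : GP = ι '' KrullFactorization.primeClasses φ)
    (hinf : {g ∈ GP | 0 < g}.Infinite)
    (a₁ a₂ b : ℤ) (ha₁ : a₁ ∈ GP) (ha₁neg : a₁ < 0) (ha₂ : a₂ ∈ GP) (ha₂neg : a₂ < 0)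
    (hb : b ∈ GP) (hbpos : 0 < b)
    -- the quotients of natural numbers below are exact, with positive divisor
    (hcong : a₁ * ((Int.gcd a₂ b / Int.gcd a₁ (Int.gcd a₂ b) : ℕ) : ℤ) ≡
      a₂ * ((Int.gcd a₁ b / Int.gcd a₁ (Int.gcd a₂ b) : ℕ) : ℤ) [ZMOD b])
    (hne : a₁ * ((Int.gcd a₂ b / Int.gcd a₁ (Int.gcd a₂ b) : ℕ) : ℤ) ≠
      a₂ * ((Int.gcd a₁ b / Int.gcd a₁ (Int.gcd a₂ b) : ℕ) : ℤ)) :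
    (∃ I : Set H,
      KrullFactorization.IsPatternIdeal I ∧ ¬ KrullFactorization.IsTamelyGenerated I) ∧
    (∃ I : Set (KrullFactorization.zeroSumMonoid GP),
      KrullFactorization.IsPatternIdeal I ∧ ¬ KrullFactorization.IsTamelyGenerated I) := by
  constructor
  · have hrange : Set.range (fun p => ι (KrullFactorization.classOf φ
        (KrullFactorization.FreeMon.of p))) = GP := by
      rw [hGP, KrullFactorization.primeClasses, ← Set.range_comp]
      rfl
    rw [← hrange] at ha₁ ha₂ hb
    refine KrullFactorization.exists_patternIdeal_of_divisorHom hdiv (fun S => ?_)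
      (by rw [hrange]; exact hinf) ha₁ ha₁neg ha₂ ha₂neg hb hbpos hcong hne
    have := KrullFactorization.map_classOf_eq_weight φ (ι : _ →+ ℤ) S
    simp only [AddMonoidHom.coe_coe] at this
    rw [← this, EmbeddingLike.map_eq_zero_iff, KrullFactorization.classOf_eq_zero_iff hdiv]
    rfl
  -- For zero-sum sequences each letter is its own weight.
  · have hrange : Set.range (fun g : GP => (g : ℤ)) = GP := Subtype.range_coe
    rw [← hrange] at ha₁ ha₂ hb
    refine KrullFactorization.exists_patternIdeal_of_divisorHom
      (KrullFactorization.isDivisorHom_zeroSumMonoid_subtype GP) (fun S => ?_)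
      (by rw [hrange]; exact hinf) ha₁ ha₁neg ha₂ ha₂neg hb hbpos hcong hne
    exact ⟨fun ⟨a, ha⟩ => ha ▸ a.2, fun h => ⟨⟨Multiplicative.ofAdd S, h⟩, rfl⟩⟩
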